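/- Let $d,n\in\mathbb N$, let $\mu=\mathcal N(m,\Sigma)$ be the Gaussian probability measure on $\mathbb R^d$ with mean $m\in\mathbb R^d$ and non-singular (that is, symmetric positive definite) covariance matrix $\Sigma\in\mathbb R^{d\times d}$. Let $R_V\in\mathbb R^{n\times n}$ be symmetric positive definite, and let $V=\mathbb R^n$ be endowed with the norm $\|v\|_V^2=v^TR_Vv$. Let $\mathcal H=L^2(\mathbb R^d,\mathcal B(\mathbb R^d),\mu;V)$, with norm $\|u\|_{\mathcal H}^2=\int_{\mathbb R^d}\|u(x)\|_V^2\,\mathrm d\mu(x)$. Let $f\in\mathcal H$ be continuously differentiable, let $\nabla f(x)=\big(\partial f_i/\partial x_j(x)\big)_{i,j}\in\mathbb R^{n\times d}$ be its Jacobian matrix, and assume that the entries of $x\mapsto(\nabla f(x))^TR_V\nabla f(x)$ are $\mu$-integrable, so that the matrix $$H=\int_{\mathbb R^d}(\nabla f(x))^TR_V\,(\nabla f(x))\,\mathrm d\mu(x)\in\mathbb R^{d\times d}$$ is well defined. Then for every projector $P_r\in\mathbb R^{d\times d}$ (that is, every matrix with $P_r^2=P_r$, of any rank and not necessarily orthogonal),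 $$\|f-\mathbb E_\mu(f\,|\,\sigma(P_r))\|_{\mathcal H}^2\;\le\;\operatorname{trace}\big(\Sigma\,(I_d-P_r^T)\,H\,(I_d-P_r)\big),$$ where $\sigma(P_r)$ is the $\sigma$-algebra on $\mathbb R^d$ generated by $x\mapsto P_rx$, and $\mathbb E_\mu(\cdot\,|\,\sigma(P_r))$ is the conditional expectation under $\mu$. -/

import Mathlib

open MeasureTheory ProbabilityTheory
open scoped ENNReal

noncomputable section

/-- The squared norm `‖v‖_V² = vᵀ R v` on `V = ℝⁿ` given by the matrix `R`. -/
def normSqV {n : ℕ} (R : Matrix (Fin n) (Fin n) ℝ) (v : EuclideanSpace ℝ (Fin n)) : ℝ :=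
  v.ofLp ⬝ᵥ R.mulVec v.ofLp

/-- The squared norm `‖u‖_H² = ∫ ‖u(x)‖_V² dμ(x)`, with value `∞` where the integral diverges. -/
def normSqH {d n : ℕ} (μ : Measure (EuclideanSpace ℝ (Fin d))) (R : Matrix (Fin n) (Fin n) ℝ)
    (u : EuclideanSpace ℝ (Fin d) → EuclideanSpace ℝ (Fin n)) : ℝ≥0∞ :=
  ∫⁻ x, ENNReal.ofReal (normSqV R (u x)) ∂μ

/-- Membership in `L²(ℝᵈ, Borel, μ; V)`: measurable (up to null sets), with finite norm. -/
def MemH {d n : ℕ} (μ : Measure (EuclideanSpace ℝ (Fin d))) (R : Matrix (Fin n) (Fin n) ℝ)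
    (u : EuclideanSpace ℝ (Fin d) → EuclideanSpace ℝ (Fin n)) : Prop :=
  AEStronglyMeasurable u μ ∧ normSqH μ R u < ∞

/-- The σ-algebra on `ℝᵈ` generated by the map `x ↦ P x`. -/
abbrev sigmaOf {d : ℕ} (P : Matrix (Fin d) (Fin d) ℝ) : MeasurableSpace (EuclideanSpace ℝ (Fin d)) :=
  MeasurableSpace.comap (fun x : EuclideanSpace ℝ (Fin d) => Matrix.toEuclideanLin P x)
    (borel (EuclideanSpace ℝ (Fin d)))

/-- The `n × d` Jacobian matrix of `f` at `x`, with entries `∂fᵢ/∂xⱼ (x)`. -/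
def jacobian {d n : ℕ} (f : EuclideanSpace ℝ (Fin d) → EuclideanSpace ℝ (Fin n))
    (x : EuclideanSpace ℝ (Fin d)) : Matrix (Fin n) (Fin d) ℝ :=
  Matrix.of fun i j => (fderiv ℝ f x (EuclideanSpace.single j 1)) i

/-- The `d × d` matrix `(∇f(x))ᵀ R (∇f(x))`. -/
def gradGram {d n : ℕ} (R : Matrix (Fin n) (Fin n) ℝ)
    (f : EuclideanSpace ℝ (Fin d) → EuclideanSpace ℝ (Fin n))
    (x : EuclideanSpace ℝ (Fin d)) : Matrix (Fin d) (Fin d) ℝ :=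
  (jacobian f x).transpose * R * jacobian f x

/-- The matrix `H = ∫ (∇f(x))ᵀ R (∇f(x)) dμ(x)`, the integral being taken entrywise. -/
def matrixH {d n : ℕ} (μ : Measure (EuclideanSpace ℝ (Fin d))) (R : Matrix (Fin n) (Fin n) ℝ)
    (f : EuclideanSpace ℝ (Fin d) → EuclideanSpace ℝ (Fin n)) : Matrix (Fin d) (Fin d) ℝ :=
  Matrix.of fun i j => ∫ x, gradGram R f x i j ∂μ

end

/-! ### One-dimensional Gaussian inequality -/

section OneDim

open Set Filter Topology

variable {W : Type*} [NormedAddCommGroup W] [InnerProductSpace ℝ W]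

/-! Conditional expectation is the best `σ(P)`-measurable approximation in `L²`, so it suffices to
find one approximant with a good error bound. Write `x = m + S^{1/2} ∑ zᵢ bᵢ` with `z` standard
Gaussian and `b` an orthonormal basis of right singular vectors of `P S^{1/2}`. The coordinates `zᵢ`
with `P S^{1/2} bᵢ ≠ 0` can be recovered from `P x`; averaging over the others gives a function of
`P x`.

The error of this average is controlled by a Gaussian Poincaré inequality in the averaged
coordinates only. Its one-dimensional case compares `f` with `f 0` by a Hardy-type argument on each
half-line (`lintegral_sub_apply_zero_sq_gaussianReal_le`). It tensorizes through independent
resampling (`lintegral_sub_piecewise_sq_le`): the energy of resampling a set of coordinates is at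
most the sum of the energies of resampling each one.

In the averaged directions `S^{1/2} bᵢ = (1 - P) S^{1/2} bᵢ`. Adding the nonnegative terms of the
remaining `i` completes the sum to a trace, which does not depend on `b`. The norm of `V` becomes
Euclidean after applying `R^{1/2}`, which commutes with conditional expectation. -/

lemma hasDerivAt_gaussianPDFReal_zero_one (x : ℝ) :
    HasDerivAt (gaussianPDFReal 0 1) (-x * gaussianPDFReal 0 1 x) x := by
  have h : HasDerivAt (fun x : ℝ => -(x - 0) ^ 2 / (2 * ((1 : NNReal) : ℝ))) (-x) x := by
    refine (((((hasDerivAt_id x).sub_const 0).pow 2).neg).div_const _).congr_deriv ?_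
    simp
    ring
  refine ((h.exp).const_mul ((√(2 * Real.pi * ((1 : NNReal) : ℝ)))⁻¹)).congr_deriv ?_
  rw [← mul_assoc, mul_comm]
  rfl

lemma continuous_gaussianPDFReal_zero_one : Continuous (gaussianPDFReal 0 1) :=
  continuous_iff_continuousAt.2 fun x => (hasDerivAt_gaussianPDFReal_zero_one x).continuousAt

/-- Hardy-type inequality on a compact interval: the derivative of `‖u‖² ρ / x` is
`(‖u'‖² - ‖u‖² - ‖u' - u / x‖²) ρ`, where `ρ` is the Gaussian density. -/
lemma intervalIntegral_sq_mul_gaussianPDFReal_le {u u' : ℝ → W}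
    (hu : ∀ x, HasDerivAt u (u' x) x) (hu' : Continuous u') {a b : ℝ} (ha : 0 < a) (hab : a ≤ b) :
    ∫ x in a..b, ‖u x‖ ^ 2 * gaussianPDFReal 0 1 x ≤
      (∫ x in a..b, ‖u' x‖ ^ 2 * gaussianPDFReal 0 1 x) + ‖u a‖ ^ 2 * gaussianPDFReal 0 1 a / a := by
  set ρ := gaussianPDFReal 0 1 with hρ
  have hρc : Continuous ρ := continuous_gaussianPDFReal_zero_one
  have huc : Continuous u := continuous_iff_continuousAt.2 fun x => (hu x).continuousAt
  have hpos : ∀ x ∈ uIcc a b, 0 < x := fun x hx => by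
    rw [uIcc_of_le hab] at hx
    exact ha.trans_le hx.1
  have hne : ∀ x ∈ uIcc a b, x ≠ 0 := fun x hx => (hpos x hx).ne'
  set q' : ℝ → ℝ := fun x => ((2 * inner ℝ (u x) (u' x) * ρ x + ‖u x‖ ^ 2 * (-x * ρ x)) * x
    - ‖u x‖ ^ 2 * ρ x * 1) / x ^ 2 with hq'
  have hq : ∀ x ∈ uIcc a b, HasDerivAt (fun x => ‖u x‖ ^ 2 * ρ x / x) (q' x) x := fun x hx =>
    ((((hu x).norm_sq).mul (hasDerivAt_gaussianPDFReal_zero_one x)).div (hasDerivAt_id x)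
      (hne x hx))
  have hi : IntervalIntegrable q' volume a b := by
    apply ContinuousOn.intervalIntegrable
    apply ContinuousOn.div _ (by fun_prop) (fun x hx => pow_ne_zero 2 (hne x hx))
    apply Continuous.continuousOn
    have := huc.inner (𝕜 := ℝ) hu'
    fun_prop
  have hftc := intervalIntegral.integral_eq_sub_of_hasDerivAt hq hi
  have hle : ∫ x in a..b, (‖u x‖ ^ 2 * ρ x + q' x) ≤ ∫ x in a..b, ‖u' x‖ ^ 2 * ρ x := by
    apply intervalIntegral.integral_mono_on hab
    · exact (Continuous.intervalIntegrable (by fun_prop) _ _).add hi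
    · exact Continuous.intervalIntegrable (by fun_prop) _ _
    · intro x hx
      have hx0 : 0 < x := ha.trans_le hx.1
      have hsq : ‖u' x - x⁻¹ • u x‖ ^ 2 =
          ‖u' x‖ ^ 2 - 2 * (x⁻¹ * inner ℝ (u x) (u' x)) + (x⁻¹) ^ 2 * ‖u x‖ ^ 2 := by
        rw [norm_sub_sq_real, norm_smul, inner_smul_right, real_inner_comm, mul_pow,
          Real.norm_eq_abs, sq_abs]
      have hid : ‖u' x‖ ^ 2 * ρ x - (‖u x‖ ^ 2 * ρ x + q' x) = ‖u' x - x⁻¹ • u x‖ ^ 2 * ρ x := by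
        rw [hsq, hq']
        field_simp
        ring
      have : 0 ≤ ‖u' x - x⁻¹ • u x‖ ^ 2 * ρ x :=
        mul_nonneg (sq_nonneg _) (gaussianPDFReal_nonneg 0 1 x)
      linarith
  rw [intervalIntegral.integral_add (Continuous.intervalIntegrable (by fun_prop) _ _) hi,
    hftc] at hle
  have : 0 ≤ ‖u b‖ ^ 2 * ρ b / b :=
    div_nonneg (mul_nonneg (sq_nonneg _) (gaussianPDFReal_nonneg 0 1 b)) (ha.le.trans hab)
  linarith

lemma setLIntegral_Icc_sq_mul_gaussianPDFReal_le {u u' : ℝ → W}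
    (hu : ∀ x, HasDerivAt u (u' x) x) (hu' : Continuous u') {a b : ℝ} (ha : 0 < a) (hab : a ≤ b) :
    ∫⁻ x in Icc a b, ENNReal.ofReal (‖u x‖ ^ 2 * gaussianPDFReal 0 1 x) ≤
      (∫⁻ x in Ioi 0, ENNReal.ofReal (‖u' x‖ ^ 2 * gaussianPDFReal 0 1 x)) +
        ENNReal.ofReal (‖u a‖ ^ 2 * gaussianPDFReal 0 1 a / a) := by
  have hρc : Continuous (gaussianPDFReal 0 1) := continuous_gaussianPDFReal_zero_one
  have huc : Continuous u := continuous_iff_continuousAt.2 fun x => (hu x).continuousAt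
  have key : ∀ v : ℝ → W, Continuous v →
      ∫⁻ x in Icc a b, ENNReal.ofReal (‖v x‖ ^ 2 * gaussianPDFReal 0 1 x) =
        ENNReal.ofReal (∫ x in a..b, ‖v x‖ ^ 2 * gaussianPDFReal 0 1 x) := fun v hv => by
    rw [intervalIntegral.integral_of_le hab, ← integral_Icc_eq_integral_Ioc,
      ofReal_integral_eq_lintegral_ofReal]
    · exact Continuous.integrableOn_Icc (by fun_prop)
    · exact ae_of_all _ fun x => mul_nonneg (sq_nonneg _) (gaussianPDFReal_nonneg 0 1 x)
  have hmono : ∫⁻ x in Icc a b, ENNReal.ofReal (‖u' x‖ ^ 2 * gaussianPDFReal 0 1 x) ≤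
      ∫⁻ x in Ioi 0, ENNReal.ofReal (‖u' x‖ ^ 2 * gaussianPDFReal 0 1 x) :=
    lintegral_mono_set fun x hx => ha.trans_le hx.1
  refine le_trans ?_ (add_le_add_left hmono _)
  rw [key u huc, key u' hu', ← ENNReal.ofReal_add]
  · exact ENNReal.ofReal_le_ofReal (intervalIntegral_sq_mul_gaussianPDFReal_le hu hu' ha hab)
  · exact intervalIntegral.integral_nonneg hab fun x _ =>
      mul_nonneg (sq_nonneg _) (gaussianPDFReal_nonneg 0 1 x)
  · exact div_nonneg (mul_nonneg (sq_nonneg _) (gaussianPDFReal_nonneg 0 1 a)) ha.le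

/-- Limit of the compact case along `[1/(n+1), n+1]`. Since `u 0 = 0`, the quotient `u a / a` tends
to `u' 0` while `u a → 0`, so the boundary term `‖u a‖² ρ(a) / a` vanishes. Working in `ℝ≥0∞` avoids
any integrability assumption. -/
lemma setLIntegral_Ioi_sq_mul_gaussianPDFReal_le {u u' : ℝ → W}
    (hu : ∀ x, HasDerivAt u (u' x) x) (hu' : Continuous u') (hu0 : u 0 = 0) :
    ∫⁻ x in Ioi 0, ENNReal.ofReal (‖u x‖ ^ 2 * gaussianPDFReal 0 1 x) ≤
      ∫⁻ x in Ioi 0, ENNReal.ofReal (‖u' x‖ ^ 2 * gaussianPDFReal 0 1 x) := by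
  have hρc : Continuous (gaussianPDFReal 0 1) := continuous_gaussianPDFReal_zero_one
  have huc : Continuous u := continuous_iff_continuousAt.2 fun x => (hu x).continuousAt
  have hε : Tendsto (fun n : ℕ => 1 / ((n : ℝ) + 1)) atTop (𝓝 0) :=
    tendsto_one_div_add_atTop_nhds_zero_nat
  have hεpos : ∀ n : ℕ, 0 < 1 / ((n : ℝ) + 1) := fun n => by positivity
  have hcover : AECover (volume.restrict (Ioi (0 : ℝ))) atTop
      (fun n : ℕ => Icc (1 / ((n : ℝ) + 1)) ((n : ℝ) + 1)) := by
    refine ⟨?_, fun n => measurableSet_Icc⟩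
    filter_upwards [ae_restrict_mem measurableSet_Ioi] with x hx
    filter_upwards [hε.eventually_lt_const hx,
      tendsto_natCast_atTop_atTop.eventually_ge_atTop x] with n h1 h2
    exact ⟨h1.le, by linarith⟩
  have hlim := hcover.lintegral_tendsto_of_countably_generated
    (f := fun x => ENNReal.ofReal (‖u x‖ ^ 2 * gaussianPDFReal 0 1 x))
    (Continuous.measurable (by fun_prop)).ennreal_ofReal.aemeasurable
  have hbdry : Tendsto (fun a : ℝ => ‖u a‖ ^ 2 * gaussianPDFReal 0 1 a / a) (𝓝[>] 0) (𝓝 0) := by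
    have hslope : Tendsto (fun a : ℝ => a⁻¹ • u a) (𝓝[>] 0) (𝓝 (u' 0)) := by
      have := (hasDerivAt_iff_tendsto_slope_zero.1 (hu 0)).mono_left
        (nhdsWithin_mono 0 (fun x (hx : x ∈ Ioi 0) => (mem_Ioi.1 hx).ne'))
      simpa only [zero_add, hu0, sub_zero] using this
    have h2 : Tendsto (fun a : ℝ => ‖a⁻¹ • u a‖ * ‖u a‖ * gaussianPDFReal 0 1 a) (𝓝[>] 0)
        (𝓝 (‖u' 0‖ * ‖u 0‖ * gaussianPDFReal 0 1 0)) :=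
      (hslope.norm.mul (huc.tendsto 0 |>.mono_left nhdsWithin_le_nhds).norm).mul
        ((hρc.tendsto 0).mono_left nhdsWithin_le_nhds)
    rw [hu0, norm_zero, mul_zero, zero_mul] at h2
    refine h2.congr' ?_
    filter_upwards [self_mem_nhdsWithin] with a ha
    rw [norm_smul, norm_inv, Real.norm_of_nonneg (le_of_lt ha)]
    field_simp
  have hb2 := ENNReal.tendsto_ofReal (hbdry.comp
    (tendsto_nhdsWithin_iff.2 ⟨hε, Eventually.of_forall hεpos⟩))
  rw [ENNReal.ofReal_zero] at hb2
  have hb3 := hb2.const_add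
    (∫⁻ x in Ioi 0, ENNReal.ofReal (‖u' x‖ ^ 2 * gaussianPDFReal 0 1 x))
  rw [add_zero] at hb3
  refine le_of_tendsto_of_tendsto' hlim hb3 fun n => ?_
  have hn : 1 / ((n : ℝ) + 1) ≤ (n : ℝ) + 1 := by
    rw [div_le_iff₀ (by positivity)]
    nlinarith [(Nat.cast_nonneg n : (0 : ℝ) ≤ n)]
  refine le_trans ?_ (setLIntegral_Icc_sq_mul_gaussianPDFReal_le hu hu' (hεpos n) hn)
  exact lintegral_mono' (Measure.restrict_mono_measure Measure.restrict_le_self _) le_rfl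

lemma gaussianPDFReal_zero_one_neg (x : ℝ) :
    gaussianPDFReal 0 1 (-x) = gaussianPDFReal 0 1 x := by
  simp [gaussianPDFReal]

lemma lintegral_eq_add_Ioi_neg (h : ℝ → ℝ≥0∞) :
    ∫⁻ x, h x = (∫⁻ x in Ioi 0, h x) + ∫⁻ x in Ioi 0, h (-x) := by
  rw [← lintegral_add_compl h (measurableSet_Ioi (a := (0 : ℝ))), compl_Ioi,
    setLIntegral_congr Iio_ae_eq_Iic.symm]
  congr 1
  have := (Measure.measurePreserving_neg (volume : Measure ℝ)).setLIntegral_comp_preimage_emb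
    (MeasurableEquiv.neg ℝ).measurableEmbedding h (Iio 0)
  rw [← this]
  congr 2
  ext x
  simp

lemma lintegral_gaussianReal_zero_one {V : Type*} [NormedAddCommGroup V] {h : ℝ → V} (hh : Continuous h) :
    ∫⁻ x, ‖h x‖ₑ ^ 2 ∂(gaussianReal 0 1) =
      ∫⁻ x, ENNReal.ofReal (‖h x‖ ^ 2 * gaussianPDFReal 0 1 x) := by
  rw [gaussianReal_of_var_ne_zero _ one_ne_zero,
    lintegral_withDensity_eq_lintegral_mul _ (measurable_gaussianPDF 0 1)
      (Continuous.measurable (by fun_prop))]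
  refine lintegral_congr fun x => ?_
  rw [Pi.mul_apply, gaussianPDF, mul_comm, ENNReal.ofReal_mul (sq_nonneg _),
    ENNReal.ofReal_pow (norm_nonneg _), ofReal_norm]

/-- Centring at `f 0` instead of the mean makes the function vanish at the origin, so the two
half-lines decouple; the negative one is reflected onto the positive one. -/
theorem lintegral_sub_apply_zero_sq_gaussianReal_le {f f' : ℝ → W}
    (hf : ∀ x, HasDerivAt f (f' x) x) (hf' : Continuous f') :
    ∫⁻ x, ‖f x - f 0‖ₑ ^ 2 ∂(gaussianReal 0 1) ≤ ∫⁻ x, ‖f' x‖ₑ ^ 2 ∂(gaussianReal 0 1) := by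
  have hfc : Continuous f := continuous_iff_continuousAt.2 fun x => (hf x).continuousAt
  rw [lintegral_gaussianReal_zero_one (by fun_prop), lintegral_gaussianReal_zero_one hf',
    lintegral_eq_add_Ioi_neg, lintegral_eq_add_Ioi_neg (fun x => ENNReal.ofReal (‖f' x‖ ^ 2 * _))]
  refine add_le_add ?_ ?_
  · exact setLIntegral_Ioi_sq_mul_gaussianPDFReal_le (fun x => (hf x).sub_const (f 0)) hf'
      (sub_self _)
  · simp only [gaussianPDFReal_zero_one_neg]
    have h := setLIntegral_Ioi_sq_mul_gaussianPDFReal_le (u := fun x => f (-x) - f 0)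
      (u' := fun x => -f' (-x))
      (fun x => by simpa using ((hf (-x)).scomp x (hasDerivAt_neg x)).sub_const (f 0))
      (by fun_prop) (by simp)
    simpa only [norm_neg] using h

end OneDim

/-! ### Variance and resampling of independent copies -/

section Resampling

variable {W : Type*} [NormedAddCommGroup W] [InnerProductSpace ℝ W]

lemma integrable_inner_of_memLp_two {Ω : Type*} [MeasurableSpace Ω] {μ : Measure Ω}
    {u v : Ω → W} (hu : MemLp u 2 μ) (hv : MemLp v 2 μ) :
    Integrable (fun x => inner ℝ (u x) (v x)) μ :=
  memLp_one_iff_integrable.1 ((innerSL ℝ : W →L[ℝ] W →L[ℝ] ℝ).memLp_of_bilin 1 hu hv)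

lemma integrable_norm_sq_of_memLp_two {V Ω : Type*} [NormedAddCommGroup V] [MeasurableSpace Ω]
    {μ : Measure Ω} {u : Ω → V} (hu : MemLp u 2 μ) : Integrable (fun x => ‖u x‖ ^ 2) μ :=
  (memLp_two_iff_integrable_sq_norm hu.1).1 hu

lemma lintegral_enorm_sq_eq_ofReal_integral {V Ω : Type*} [NormedAddCommGroup V] [MeasurableSpace Ω]
    {μ : Measure Ω} {u : Ω → V} (hu : MemLp u 2 μ) :
    ∫⁻ x, ‖u x‖ₑ ^ 2 ∂μ = ENNReal.ofReal (∫ x, ‖u x‖ ^ 2 ∂μ) := by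
  rw [ofReal_integral_eq_lintegral_ofReal (integrable_norm_sq_of_memLp_two hu)
    (ae_of_all _ fun x => sq_nonneg _)]
  refine lintegral_congr fun x => ?_
  rw [ENNReal.ofReal_pow (norm_nonneg _), ofReal_norm]

lemma memLp_two_iff_lintegral_enorm_sq_lt_top {V Ω : Type*} [NormedAddCommGroup V]
    [MeasurableSpace Ω] {μ : Measure Ω} {u : Ω → V} (hu : AEStronglyMeasurable u μ) :
    MemLp u 2 μ ↔ ∫⁻ x, ‖u x‖ₑ ^ 2 ∂μ < ∞ := by
  refine ⟨fun h => ?_, fun h => ⟨hu, ?_⟩⟩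
  · rw [lintegral_enorm_sq_eq_ofReal_integral h]
    exact ENNReal.ofReal_lt_top
  · rw [eLpNorm_lt_top_iff_lintegral_rpow_enorm_lt_top two_ne_zero ENNReal.ofNat_ne_top]
    simpa using h

/-- Energy identity for a square-integrable `u` and a measure-preserving `T : Ω × Ω → Ω`. -/
lemma integral_sub_comp_sq {Ω : Type*} [MeasurableSpace Ω] {μ : Measure Ω}
    [IsProbabilityMeasure μ] {T : Ω × Ω → Ω} (hT : MeasurePreserving T (μ.prod μ) μ)
    {u : Ω → W} (hu : MemLp u 2 μ) :
    ∫ z, ‖u z.1 - u (T z)‖ ^ 2 ∂(μ.prod μ) + 2 * ∫ z, inner ℝ (u z.1) (u (T z)) ∂(μ.prod μ) =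
      2 * ∫ x, ‖u x‖ ^ 2 ∂μ := by
  have h1 : MemLp (fun z : Ω × Ω => u z.1) 2 (μ.prod μ) :=
    hu.comp_measurePreserving measurePreserving_fst
  have h2 : MemLp (fun z : Ω × Ω => u (T z)) 2 (μ.prod μ) := hu.comp_measurePreserving hT
  have e1 : ∫ z, ‖u z.1‖ ^ 2 ∂(μ.prod μ) = ∫ x, ‖u x‖ ^ 2 ∂μ := by
    have := integral_map (μ := μ.prod μ) (φ := Prod.fst) measurable_fst.aemeasurable
      (f := fun x => ‖u x‖ ^ 2) (by
        rw [measurePreserving_fst.map_eq]; exact (hu.1.norm.pow 2))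
    rw [← this, measurePreserving_fst.map_eq]
  have e2 : ∫ z, ‖u (T z)‖ ^ 2 ∂(μ.prod μ) = ∫ x, ‖u x‖ ^ 2 ∂μ := by
    have := integral_map (μ := μ.prod μ) (φ := T) hT.measurable.aemeasurable
      (f := fun x => ‖u x‖ ^ 2) (by
        rw [hT.map_eq]; exact (hu.1.norm.pow 2))
    rw [← this, hT.map_eq]
  have hpt : ∀ z, ‖u z.1 - u (T z)‖ ^ 2 =
      ‖u z.1‖ ^ 2 + ‖u (T z)‖ ^ 2 - 2 * inner ℝ (u z.1) (u (T z)) := fun z => by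
    rw [norm_sub_sq_real]; ring
  have hi1 : Integrable (fun z => ‖u z.1‖ ^ 2) (μ.prod μ) := (integrable_norm_sq_of_memLp_two h1)
  have hi2 : Integrable (fun z => ‖u (T z)‖ ^ 2) (μ.prod μ) := (integrable_norm_sq_of_memLp_two h2)
  have hi3 : Integrable (fun z => inner ℝ (u z.1) (u (T z))) (μ.prod μ) := integrable_inner_of_memLp_two h1 h2
  simp_rw [hpt]
  rw [integral_sub (f := fun z => ‖u z.1‖ ^ 2 + ‖u (T z)‖ ^ 2) (hi1.add hi2) (hi3.const_mul 2), integral_add hi1 hi2, integral_const_mul,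
    e1, e2]
  ring

/-- With `u = F - c`, expanding the square leaves the cross term `-2 ‖∫ u‖² ≤ 0`. If `u` is not
square-integrable the right side is infinite. -/
lemma lintegral_prod_sub_sq_le [CompleteSpace W] {Ω : Type*} [MeasurableSpace Ω] {μ : Measure Ω}
    [IsProbabilityMeasure μ] {F : Ω → W} (hF : AEStronglyMeasurable F μ) (c : W) :
    ∫⁻ z, ‖F z.1 - F z.2‖ₑ ^ 2 ∂(μ.prod μ) ≤ 2 * ∫⁻ x, ‖F x - c‖ₑ ^ 2 ∂μ := by
  set u : Ω → W := fun x => F x - c with hu_def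
  have hum : AEStronglyMeasurable u μ := hF.sub aestronglyMeasurable_const
  by_cases hfin : ∫⁻ x, ‖u x‖ₑ ^ 2 ∂μ < ∞
  · have hu : MemLp u 2 μ := (memLp_two_iff_lintegral_enorm_sq_lt_top hum).2 hfin
    have hsub : ∀ z : Ω × Ω, F z.1 - F z.2 = u z.1 - u z.2 := fun z => by simp [hu_def]
    have h1 : MemLp (fun z : Ω × Ω => u z.1) 2 (μ.prod μ) :=
      hu.comp_measurePreserving measurePreserving_fst
    have h2 : MemLp (fun z : Ω × Ω => u z.2) 2 (μ.prod μ) :=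
      hu.comp_measurePreserving measurePreserving_snd
    have hui : Integrable u μ := hu.integrable one_le_two
    have hin : 0 ≤ ∫ z, inner ℝ (u z.1) (u z.2) ∂(μ.prod μ) := by
      rw [integral_prod _ (integrable_inner_of_memLp_two h1 h2)]
      have e1 : ∀ x, ∫ y, inner ℝ (u x) (u y) ∂μ = inner ℝ (∫ y, u y ∂μ) (u x) := fun x => by
        rw [integral_inner hui, real_inner_comm]
      simp only [e1]
      rw [integral_inner hui]
      exact real_inner_self_nonneg
    have hid := integral_sub_comp_sq (μ := μ) measurePreserving_snd hu
    simp_rw [hsub]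
    rw [lintegral_enorm_sq_eq_ofReal_integral hu,
      lintegral_enorm_sq_eq_ofReal_integral (u := fun z : Ω × Ω => u z.1 - u z.2) (h1.sub h2),
      ← ENNReal.ofReal_ofNat 2, ← ENNReal.ofReal_mul zero_le_two]
    exact ENNReal.ofReal_le_ofReal (by linarith)
  · rw [not_lt, top_le_iff] at hfin
    rw [hfin, ENNReal.mul_top two_ne_zero]
    exact le_top

lemma enorm_integral_sq_le {Ω : Type*} [MeasurableSpace Ω] {μ : Measure Ω}
    [IsProbabilityMeasure μ] {u : Ω → W} (hu : AEStronglyMeasurable u μ) :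
    ‖∫ x, u x ∂μ‖ₑ ^ 2 ≤ ∫⁻ x, ‖u x‖ₑ ^ 2 ∂μ := by
  have h1 := eLpNorm_le_eLpNorm_of_exponent_le (μ := μ) (p := 1) (q := 2) one_le_two hu
  rw [eLpNorm_one_eq_lintegral_enorm, eLpNorm_eq_lintegral_rpow_enorm_toReal two_ne_zero
    ENNReal.ofNat_ne_top] at h1
  have h2 := pow_le_pow_left' ((enorm_integral_le_lintegral_enorm u).trans h1) 2
  refine h2.trans (le_of_eq ?_)
  rw [← ENNReal.rpow_natCast, ← ENNReal.rpow_mul]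
  simp

/-- If `T` resamples part of the randomness (so that resampling twice in a row is the same as
resampling once), the distance from `F` to its average over the resampled part is half the
energy of `F - F ∘ T`. -/
lemma lintegral_sub_resample_average_sq [CompleteSpace W] {Ω : Type*} [MeasurableSpace Ω]
    {μ : Measure Ω} [IsProbabilityMeasure μ] {T : Ω × Ω → Ω}
    (hT : MeasurePreserving T (μ.prod μ) μ) (hTT : ∀ x y y', T (T (x, y), y') = T (x, y'))
    {F : Ω → W} (hFm : StronglyMeasurable F) (hF : MemLp F 2 μ) :
    MemLp (fun x => ∫ y, F (T (x, y)) ∂μ) 2 μ ∧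
    2 * ∫⁻ x, ‖F x - ∫ y, F (T (x, y)) ∂μ‖ₑ ^ 2 ∂μ =
      ∫⁻ z, ‖F z.1 - F (T z)‖ₑ ^ 2 ∂(μ.prod μ) := by
  have hFT : StronglyMeasurable (fun z => F (T z)) := hFm.comp_measurable hT.measurable
  set g : Ω → W := fun x => ∫ y, F (T (x, y)) ∂μ with hg_def
  have hgm : StronglyMeasurable g := hFT.integral_prod_right'
  have hFT2 : MemLp (fun z => F (T z)) 2 (μ.prod μ) := hF.comp_measurePreserving hT
  have hg : MemLp g 2 μ := by
    rw [memLp_two_iff_lintegral_enorm_sq_lt_top hgm.aestronglyMeasurable]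
    calc ∫⁻ x, ‖g x‖ₑ ^ 2 ∂μ ≤ ∫⁻ x, ∫⁻ y, ‖F (T (x, y))‖ₑ ^ 2 ∂μ ∂μ :=
          lintegral_mono fun x => enorm_integral_sq_le
            (hFT.comp_measurable measurable_prodMk_left).aestronglyMeasurable
      _ = ∫⁻ z, ‖F (T z)‖ₑ ^ 2 ∂(μ.prod μ) :=
          (lintegral_prod _ (hFT.enorm.pow_const 2).aemeasurable).symm
      _ < ∞ := (memLp_two_iff_lintegral_enorm_sq_lt_top hFT2.1).1 hFT2
  refine ⟨hg, ?_⟩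
  -- The average `g` is unchanged by resampling, so `F` may be replaced by `u = F - g` in the
  -- energy.
  have hgT : ∀ x y, g (T (x, y)) = g x := fun x y => by simp only [hg_def, hTT]
  set u : Ω → W := fun x => F x - g x with hu_def
  have hu : MemLp u 2 μ := hF.sub hg
  have hsub : ∀ z : Ω × Ω, F z.1 - F (T z) = u z.1 - u (T z) := fun z => by
    simp [hu_def, hgT z.1 z.2]
  have h1 : MemLp (fun z : Ω × Ω => u z.1) 2 (μ.prod μ) :=
    hu.comp_measurePreserving measurePreserving_fst
  have h2 : MemLp (fun z : Ω × Ω => u (T z)) 2 (μ.prod μ) := hu.comp_measurePreserving hT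
  -- For almost every fixed `x`, `u (T (x, y)) = F (T (x, y)) - g x` has mean zero in `y`.
  have hin : ∫ z, inner ℝ (u z.1) (u (T z)) ∂(μ.prod μ) = 0 := by
    rw [integral_prod _ (integrable_inner_of_memLp_two h1 h2)]
    refine integral_eq_zero_of_ae ?_
    filter_upwards [(hFT2.integrable one_le_two).prod_right_ae] with x hx
    have hx' : Integrable (fun y => u (T (x, y))) μ := by
      simp only [hu_def, hgT]
      exact hx.sub (integrable_const _)
    simp only [Pi.zero_apply]
    rw [integral_inner hx']
    simp only [hu_def, hgT]
    rw [integral_sub hx (integrable_const _)]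
    simp [hg_def]
  have hid := integral_sub_comp_sq hT hu
  rw [hin, mul_zero, add_zero] at hid
  simp_rw [hsub]
  rw [lintegral_enorm_sq_eq_ofReal_integral hu, lintegral_enorm_sq_eq_ofReal_integral (u := fun z : Ω × Ω => u z.1 - u (T z)) (h1.sub h2)]
  rw [hid, ENNReal.ofReal_mul zero_le_two, ENNReal.ofReal_ofNat]

end Resampling

/-! ### Conditional expectation as best `L²` approximation -/

section CondExp

/-- Pythagoras: `D = F - E[F|m]` has zero conditional expectation, hence is orthogonal to the
`m`-measurable `K = E[F|m] - G`. -/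
lemma lintegral_sub_condExp_sq_le {W : Type*} [NormedAddCommGroup W] [InnerProductSpace ℝ W]
    [CompleteSpace W] {Ω : Type*} {m m0 : MeasurableSpace Ω} {μ : Measure[m0] Ω}
    [IsProbabilityMeasure μ] (hm : m ≤ m0) {F G : Ω → W} (hF : MemLp F 2 μ)
    (hGm : StronglyMeasurable[m] G) (hG : MemLp G 2 μ) :
    ∫⁻ x, ‖F x - (μ[F | m]) x‖ₑ ^ 2 ∂μ ≤ ∫⁻ x, ‖F x - G x‖ₑ ^ 2 ∂μ := by
  have hE : MemLp (μ[F | m]) 2 μ := hF.condExp one_le_two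
  set D : Ω → W := fun x => F x - (μ[F | m]) x with hD
  set K : Ω → W := fun x => (μ[F | m]) x - G x with hK
  have hDm : MemLp D 2 μ := hF.sub hE
  have hKm : MemLp K 2 μ := hE.sub hG
  have hKs : StronglyMeasurable[m] K := stronglyMeasurable_condExp.sub hGm
  have hcross : ∫ x, inner ℝ (K x) (D x) ∂μ = 0 := by
    have hpull := condExp_bilin_of_stronglyMeasurable_left (innerSL ℝ) hKs
      (integrable_inner_of_memLp_two hKm hDm) (hDm.integrable one_le_two)
    have hD0 : μ[D | m] =ᵐ[μ] 0 := by
      refine (condExp_sub (hF.integrable one_le_two) integrable_condExp m).trans ?_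
      rw [condExp_of_stronglyMeasurable hm stronglyMeasurable_condExp integrable_condExp]
      simp
    rw [← integral_condExp hm]
    refine integral_eq_zero_of_ae (hpull.trans ?_)
    filter_upwards [hD0] with x hx
    simp [hx]
  have hsum : ∀ x, ‖F x - G x‖ ^ 2 = ‖D x‖ ^ 2 + ‖K x‖ ^ 2 + 2 * inner ℝ (K x) (D x) := fun x => by
    have : F x - G x = D x + K x := by simp [hD, hK]
    rw [this, norm_add_sq_real, real_inner_comm]
    ring
  have hint : ∫ x, ‖F x - G x‖ ^ 2 ∂μ = ∫ x, ‖D x‖ ^ 2 ∂μ + ∫ x, ‖K x‖ ^ 2 ∂μ := by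
    simp_rw [hsum]
    have i1 : Integrable (fun x => ‖D x‖ ^ 2) μ := (integrable_norm_sq_of_memLp_two hDm)
    have i2 : Integrable (fun x => ‖K x‖ ^ 2) μ := (integrable_norm_sq_of_memLp_two hKm)
    rw [integral_add (f := fun x => ‖D x‖ ^ 2 + ‖K x‖ ^ 2) (i1.add i2) ((integrable_inner_of_memLp_two hKm hDm).const_mul 2), integral_add i1 i2,
      integral_const_mul, hcross, mul_zero, add_zero]
  rw [lintegral_enorm_sq_eq_ofReal_integral hDm, lintegral_enorm_sq_eq_ofReal_integral (u := fun x => F x - G x)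
    (hF.sub hG)]
  refine ENNReal.ofReal_le_ofReal ?_
  rw [hint]
  have : 0 ≤ ∫ x, ‖K x‖ ^ 2 ∂μ := integral_nonneg fun x => sq_nonneg _
  linarith

end CondExp

/-! ### Subadditivity of the resampling energy -/

section Tensorization

variable {ι α : Type*} [Fintype ι] [DecidableEq ι] [MeasurableSpace α]

/-- Exchanging the coordinates in `s` of two independent samples preserves the measure. -/
lemma measurePreserving_piecewise_swap (γ : Measure α) [IsProbabilityMeasure γ] (s : Finset ι) :
    MeasurePreserving
      (fun z : (ι → α) × (ι → α) => (s.piecewise z.2 z.1, s.piecewise z.1 z.2))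
      ((Measure.pi fun _ => γ).prod (Measure.pi fun _ => γ))
      ((Measure.pi fun _ => γ).prod (Measure.pi fun _ => γ)) := by
  -- Regrouping the two samples as one family of pairs makes the exchange act coordinate by
  -- coordinate.
  have he := measurePreserving_arrowProdEquivProdArrow α α ι (fun _ => γ) (fun _ => γ)
  have hsw : MeasurePreserving (fun (w : ι → α × α) i => if i ∈ s then (w i).swap else w i)
      (Measure.pi fun _ => γ.prod γ) (Measure.pi fun _ => γ.prod γ) := by
    refine measurePreserving_pi (f := fun i (p : α × α) => if i ∈ s then p.swap else p)
      (fun _ => γ.prod γ) (fun _ => γ.prod γ) fun i => ?_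
    by_cases hi : i ∈ s
    · simpa only [hi, if_true] using Measure.measurePreserving_swap
    · simpa only [hi, if_false] using! MeasurePreserving.id _
  have h := he.comp (hsw.comp (MeasurePreserving.symm _ he))
  convert h using 1
  ext z i <;> by_cases hi : i ∈ s <;>
    simp [hi, MeasurableEquiv.arrowProdEquivProdArrow, Equiv.arrowProdEquivProdArrow]

lemma measurePreserving_piecewise (γ : Measure α) [IsProbabilityMeasure γ] (s : Finset ι) :
    MeasurePreserving (fun z : (ι → α) × (ι → α) => s.piecewise z.2 z.1)
      ((Measure.pi fun _ => γ).prod (Measure.pi fun _ => γ)) (Measure.pi fun _ => γ) :=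
  measurePreserving_fst.comp (measurePreserving_piecewise_swap γ s)

lemma piecewise_piecewise_swap {ι α : Type*} [DecidableEq ι] (s : Finset ι) (x y : ι → α) :
    s.piecewise (s.piecewise x y) (s.piecewise y x) = x := by
  ext j
  by_cases hj : j ∈ s <;> simp [hj]

lemma insert_piecewise_swap_singleton {ι α : Type*} [DecidableEq ι] {s : Finset ι} {i : ι}
    (hi : i ∉ s) (x y : ι → α) :
    (insert i s).piecewise (({i} : Finset ι).piecewise x y) (({i} : Finset ι).piecewise y x) =
      s.piecewise y x := by
  ext j
  simp only [Finset.piecewise]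
  grind

lemma insert_piecewise_swap {ι α : Type*} [DecidableEq ι] {s : Finset ι} {i : ι}
    (hi : i ∉ s) (x y : ι → α) :
    (insert i s).piecewise (s.piecewise x y) (s.piecewise y x) =
      ({i} : Finset ι).piecewise y x := by
  ext j
  simp only [Finset.piecewise]
  grind

variable {W : Type*} [NormedAddCommGroup W] [InnerProductSpace ℝ W]

/-- In a quadrilateral, the sum of the squares of the diagonals is at most that of the sides. -/
lemma enorm_sq_diagonals_le (a b c e : W) :
    ‖a - b‖ₑ ^ 2 + ‖c - e‖ₑ ^ 2 ≤
      (‖a - c‖ₑ ^ 2 + ‖a - e‖ₑ ^ 2) + (‖b - c‖ₑ ^ 2 + ‖b - e‖ₑ ^ 2) := by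
  have hcast : ∀ v : W, ‖v‖ₑ ^ 2 = ENNReal.ofReal (‖v‖ ^ 2) := fun v => by
    rw [ENNReal.ofReal_pow (norm_nonneg _), ofReal_norm]
  simp only [hcast]
  repeat rw [← ENNReal.ofReal_add (by positivity) (by positivity)]
  refine ENNReal.ofReal_le_ofReal ?_
  -- Sides minus diagonals equals exactly `‖a + b - c - e‖²`.
  have h := sq_nonneg ‖(a - c) + (b - e)‖
  have hsq : ∀ v : W, ‖v‖ ^ 2 = inner ℝ v v := fun v => (real_inner_self_eq_norm_sq v).symm
  simp only [hsq, inner_add_left, inner_add_right, inner_sub_left, inner_sub_right,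
    real_inner_comm a, real_inner_comm b c, real_inner_comm b e, real_inner_comm c e] at h ⊢
  linarith

/-- Induction on `s`. The values of `F` after resampling nothing, `{i}`, `insert i s` and `s` form a
quadrilateral. By exchangeability its diagonals have equal energy and so do opposite sides, so the
quadrilateral inequality halves to: energy of `insert i s` ≤ energy of `{i}` + energy of `s`. -/
lemma lintegral_sub_piecewise_sq_le [MeasurableSpace W] [BorelSpace W]
    [SecondCountableTopology W] (γ : Measure α) [IsProbabilityMeasure γ] {F : (ι → α) → W}
    (hF : Measurable F) (s : Finset ι) :
    ∫⁻ z, ‖F z.1 - F (s.piecewise z.2 z.1)‖ₑ ^ 2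
        ∂((Measure.pi fun _ => γ).prod (Measure.pi fun _ => γ)) ≤
      ∑ i ∈ s, ∫⁻ z, ‖F z.1 - F (Function.update z.1 i (z.2 i))‖ₑ ^ 2
        ∂((Measure.pi fun _ => γ).prod (Measure.pi fun _ => γ)) := by
  induction s using Finset.induction_on with
  | empty => simp
  | insert i s hi ih =>
    rw [Finset.sum_insert hi]
    set ν := (Measure.pi fun _ : ι => γ).prod (Measure.pi fun _ : ι => γ) with hν
    have hup : ∀ z : (ι → α) × (ι → α),
        Function.update z.1 i (z.2 i) = ({i} : Finset ι).piecewise z.2 z.1 := fun z =>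
      (Finset.piecewise_singleton z.2 z.1 i).symm
    simp_rw [hup] at ih ⊢
    have hm : ∀ t : Finset ι, Measurable fun z : (ι → α) × (ι → α) =>
        F (t.piecewise z.2 z.1) := fun t =>
      hF.comp (measurePreserving_piecewise γ t).measurable
    have hm0 : Measurable fun z : (ι → α) × (ι → α) => F z.1 := hF.comp measurable_fst
    have hmsq : ∀ {f g : (ι → α) × (ι → α) → W}, Measurable f → Measurable g →
        Measurable fun z => ‖f z - g z‖ₑ ^ 2 := fun hf hg => (hf.sub hg).enorm.pow_const 2
    have hswap : ∀ (t : Finset ι) (h : (ι → α) × (ι → α) → ℝ≥0∞), Measurable h →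
        ∫⁻ z, h (t.piecewise z.2 z.1, t.piecewise z.1 z.2) ∂ν = ∫⁻ z, h z ∂ν := fun t h hh =>
      (measurePreserving_piecewise_swap γ t).lintegral_comp hh
    have hce : ∫⁻ z, ‖F (({i} : Finset ι).piecewise z.2 z.1) - F (s.piecewise z.2 z.1)‖ₑ ^ 2 ∂ν =
        ∫⁻ z, ‖F z.1 - F ((insert i s).piecewise z.2 z.1)‖ₑ ^ 2 ∂ν := by
      rw [← hswap {i} _ (hmsq hm0 (hm (insert i s)))]
      simp only [insert_piecewise_swap_singleton hi]
    have hbc : ∫⁻ z, ‖F ((insert i s).piecewise z.2 z.1) -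
          F (({i} : Finset ι).piecewise z.2 z.1)‖ₑ ^ 2 ∂ν =
        ∫⁻ z, ‖F z.1 - F (s.piecewise z.2 z.1)‖ₑ ^ 2 ∂ν := by
      rw [← hswap {i} _ (hmsq (hm (insert i s)) (hm {i}))]
      simp only [insert_piecewise_swap_singleton hi, piecewise_piecewise_swap]
      simp only [enorm_sub_rev]
    have hbe : ∫⁻ z, ‖F ((insert i s).piecewise z.2 z.1) - F (s.piecewise z.2 z.1)‖ₑ ^ 2 ∂ν =
        ∫⁻ z, ‖F z.1 - F (({i} : Finset ι).piecewise z.2 z.1)‖ₑ ^ 2 ∂ν := by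
      rw [← hswap s _ (hmsq (hm (insert i s)) (hm s))]
      simp only [insert_piecewise_swap hi, piecewise_piecewise_swap]
      simp only [enorm_sub_rev]
    have hq := lintegral_mono (μ := ν) fun z => enorm_sq_diagonals_le (F z.1)
      (F ((insert i s).piecewise z.2 z.1)) (F (({i} : Finset ι).piecewise z.2 z.1))
      (F (s.piecewise z.2 z.1))
    have hsides : Measurable fun z : (ι → α) × (ι → α) =>
        ‖F z.1 - F (({i} : Finset ι).piecewise z.2 z.1)‖ₑ ^ 2 +
          ‖F z.1 - F (s.piecewise z.2 z.1)‖ₑ ^ 2 := (hmsq hm0 (hm {i})).add (hmsq hm0 (hm s))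
    rw [lintegral_add_left (hmsq hm0 (hm _)),
      lintegral_add_left hsides,
      lintegral_add_left (hmsq hm0 (hm _)), lintegral_add_left (hmsq (hm _) (hm _)),
      hce, hbc, hbe,
      add_comm (∫⁻ z, ‖F z.1 - F (s.piecewise z.2 z.1)‖ₑ ^ 2 ∂ν), ← two_mul, ← two_mul] at hq
    exact (ENNReal.mul_le_mul_iff_right two_ne_zero ENNReal.ofNat_ne_top).1 hq |>.trans
      (add_le_add_right ih _)

end Tensorization

/-! ### Gaussian Poincaré inequality in several variables -/

section GaussianPoincare

variable {ι : Type*} [Fintype ι] [DecidableEq ι]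

lemma lintegral_lintegral_update {α : Type*} [MeasurableSpace α] (γ : Measure α)
    [IsProbabilityMeasure γ] (i : ι) {K : (ι → α) → ℝ≥0∞} (hK : Measurable K) :
    ∫⁻ x, ∫⁻ r, K (Function.update x i r) ∂γ ∂(Measure.pi fun _ : ι => γ) =
      ∫⁻ x, K x ∂(Measure.pi fun _ : ι => γ) := by
  have hT := measurePreserving_piecewise (ι := ι) γ {i}
  rw [← hT.lintegral_comp hK, lintegral_prod (fun z : (ι → α) × (ι → α) =>
    K (({i} : Finset ι).piecewise z.2 z.1)) (hK.comp hT.measurable).aemeasurable]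
  refine lintegral_congr fun x => ?_
  simp only [Finset.piecewise_singleton]
  exact ((measurePreserving_eval (fun _ : ι => γ) i).lintegral_comp
    (hK.comp (measurable_update x))).symm

variable {W : Type*} [NormedAddCommGroup W] [InnerProductSpace ℝ W] [CompleteSpace W]
  [MeasurableSpace W] [BorelSpace W] [SecondCountableTopology W]

lemma lintegral_prod_sub_sq_gaussianReal_le {f f' : ℝ → W}
    (hf : ∀ x, HasDerivAt f (f' x) x) (hf' : Continuous f') :
    ∫⁻ r, ∫⁻ t, ‖f r - f t‖ₑ ^ 2 ∂(gaussianReal 0 1) ∂(gaussianReal 0 1) ≤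
      2 * ∫⁻ x, ‖f' x‖ₑ ^ 2 ∂(gaussianReal 0 1) := by
  have hfc : Continuous f := continuous_iff_continuousAt.2 fun x => (hf x).continuousAt
  have hm : Measurable fun z : ℝ × ℝ => ‖f z.1 - f z.2‖ₑ ^ 2 :=
    ((hfc.measurable.comp measurable_fst).sub
      (hfc.measurable.comp measurable_snd)).enorm.pow_const 2
  rw [← lintegral_prod (fun z : ℝ × ℝ => ‖f z.1 - f z.2‖ₑ ^ 2) hm.aemeasurable]
  refine (lintegral_prod_sub_sq_le hfc.aestronglyMeasurable (f 0)).trans ?_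
  gcongr 2 * ?_
  exact lintegral_sub_apply_zero_sq_gaussianReal_le hf hf'

/-- The one-dimensional inequality on each line parallel to the `i`-th axis, integrated over the
lines. The factor `2` comes from comparing two independent copies. -/
lemma lintegral_sub_update_sq_gaussian_le {F : (ι → ℝ) → W} (hF : ContDiff ℝ 1 F) (i : ι) :
    ∫⁻ z, ‖F z.1 - F (Function.update z.1 i (z.2 i))‖ₑ ^ 2
        ∂((Measure.pi fun _ : ι => gaussianReal 0 1).prod
          (Measure.pi fun _ : ι => gaussianReal 0 1)) ≤
      2 * ∫⁻ x, ‖fderiv ℝ F x (Pi.single i 1)‖ₑ ^ 2 ∂(Measure.pi fun _ : ι => gaussianReal 0 1) := by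
  set γ := gaussianReal 0 1
  have hFm : Measurable F := hF.continuous.measurable
  have hup : Measurable fun p : (ι → ℝ) × ℝ => Function.update p.1 i p.2 :=
    (Continuous.update continuous_fst i continuous_snd).measurable
  have hk : Measurable fun p : (ι → ℝ) × ℝ => ‖F p.1 - F (Function.update p.1 i p.2)‖ₑ ^ 2 :=
    ((hFm.comp measurable_fst).sub (hFm.comp hup)).enorm.pow_const 2
  have hK : Measurable fun x => ∫⁻ t, ‖F x - F (Function.update x i t)‖ₑ ^ 2 ∂γ :=
    hk.lintegral_prod_right'
  have hdc : Continuous fun x => fderiv ℝ F x (Pi.single i 1) :=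
    (hF.continuous_fderiv one_ne_zero).clm_apply continuous_const
  have hDup : Measurable fun p : (ι → ℝ) × ℝ =>
      ‖fderiv ℝ F (Function.update p.1 i p.2) (Pi.single i 1)‖ₑ ^ 2 :=
    (hdc.measurable.comp hup).enorm.pow_const 2
  have hD : Measurable fun x => ‖fderiv ℝ F x (Pi.single i 1)‖ₑ ^ 2 :=
    hdc.measurable.enorm.pow_const 2
  rw [lintegral_prod (fun z : (ι → ℝ) × (ι → ℝ) =>
    ‖F z.1 - F (Function.update z.1 i (z.2 i))‖ₑ ^ 2) ((hk.comp (measurable_fst.prodMk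
    ((measurable_pi_apply i).comp measurable_snd))).aemeasurable)]
  calc ∫⁻ x, ∫⁻ y, ‖F x - F (Function.update x i (y i))‖ₑ ^ 2
        ∂(Measure.pi fun _ : ι => γ) ∂(Measure.pi fun _ : ι => γ)
      = ∫⁻ x, ∫⁻ t, ‖F x - F (Function.update x i t)‖ₑ ^ 2 ∂γ ∂(Measure.pi fun _ : ι => γ) :=
        lintegral_congr fun x => (measurePreserving_eval (fun _ : ι => γ) i).lintegral_comp
          (hk.comp measurable_prodMk_left)
    -- Refreshing coordinate `i` of `x` by an independent `r` preserves the law and leaves two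
    -- independent points `r`, `t` on one line.
    _ = ∫⁻ x, ∫⁻ r, ∫⁻ t, ‖F (Function.update x i r) - F (Function.update x i t)‖ₑ ^ 2 ∂γ ∂γ
          ∂(Measure.pi fun _ : ι => γ) := by
        rw [← lintegral_lintegral_update γ i hK]
        simp only [Function.update_idem]
    _ ≤ ∫⁻ x, 2 * ∫⁻ r, ‖fderiv ℝ F (Function.update x i r) (Pi.single i 1)‖ₑ ^ 2 ∂γ
          ∂(Measure.pi fun _ : ι => γ) := by
        refine lintegral_mono fun x => lintegral_prod_sub_sq_gaussianReal_le
          (f := fun r => F (Function.update x i r))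
          (f' := fun r => fderiv ℝ F (Function.update x i r) (Pi.single i 1)) (fun r => ?_) ?_
        · exact ((hF.differentiable one_ne_zero) _).hasFDerivAt.comp_hasDerivAt r
            (hasDerivAt_update x i r)
        · exact hdc.comp (continuous_const.update i continuous_id)
    _ = 2 * ∫⁻ x, ‖fderiv ℝ F x (Pi.single i 1)‖ₑ ^ 2 ∂(Measure.pi fun _ : ι => γ) := by
        rw [lintegral_const_mul _ hDup.lintegral_prod_right',
          lintegral_lintegral_update γ i hD]

/-- Partial Gaussian Poincaré inequality: averaging out the coordinates in `s` costs at most the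
energy of the partial derivatives along `s`. -/
theorem lintegral_sub_partial_average_sq_le {F : (ι → ℝ) → W} (hF : ContDiff ℝ 1 F)
    (hF2 : MemLp F 2 (Measure.pi fun _ : ι => gaussianReal 0 1)) (s : Finset ι) :
    MemLp (fun x => ∫ y, F (s.piecewise y x) ∂(Measure.pi fun _ : ι => gaussianReal 0 1)) 2
        (Measure.pi fun _ : ι => gaussianReal 0 1) ∧
      ∫⁻ x, ‖F x - ∫ y, F (s.piecewise y x) ∂(Measure.pi fun _ : ι => gaussianReal 0 1)‖ₑ ^ 2
          ∂(Measure.pi fun _ : ι => gaussianReal 0 1) ≤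
        ∑ i ∈ s, ∫⁻ x, ‖fderiv ℝ F x (Pi.single i 1)‖ₑ ^ 2
          ∂(Measure.pi fun _ : ι => gaussianReal 0 1) := by
  obtain ⟨h1, h2⟩ := lintegral_sub_resample_average_sq
    (measurePreserving_piecewise (ι := ι) (gaussianReal 0 1) s)
    (fun x y y' => by ext j; by_cases hj : j ∈ s <;> simp [hj])
    hF.continuous.stronglyMeasurable hF2
  refine ⟨h1, (ENNReal.mul_le_mul_iff_right two_ne_zero ENNReal.ofNat_ne_top).1 ?_⟩
  rw [h2, Finset.mul_sum]
  exact (lintegral_sub_piecewise_sq_le _ hF.continuous.measurable s).trans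
    (Finset.sum_le_sum fun i _ => lintegral_sub_update_sq_gaussian_le hF i)

end GaussianPoincare

/-! ### Adapted bases, matrix square roots and traces -/

section LinearAlgebra

open Matrix
open scoped MatrixOrder

/-- An eigenbasis of the symmetric operator `A* A` works, since `⟨A bᵢ, A bⱼ⟩ = ⟨bᵢ, A* A bⱼ⟩`. -/
lemma exists_orthonormalBasis_inner_map_eq_zero {E F : Type*} [NormedAddCommGroup E]
    [InnerProductSpace ℝ E] [FiniteDimensional ℝ E] [NormedAddCommGroup F]
    [InnerProductSpace ℝ F] [FiniteDimensional ℝ F] {d : ℕ} (hd : Module.finrank ℝ E = d)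
    (A : E →ₗ[ℝ] F) :
    ∃ b : OrthonormalBasis (Fin d) ℝ E, ∀ i j, i ≠ j → inner ℝ (A (b i)) (A (b j)) = 0 := by
  have hT : (LinearMap.adjoint A ∘ₗ A).IsSymmetric := fun x y => by
    simp only [LinearMap.comp_apply, LinearMap.adjoint_inner_left, LinearMap.adjoint_inner_right]
  refine ⟨hT.eigenvectorBasis hd, fun i j hij => ?_⟩
  have h := hT.apply_eigenvectorBasis hd j
  rw [← LinearMap.adjoint_inner_right, ← LinearMap.comp_apply, h, inner_smul_right,
    (hT.eigenvectorBasis hd).inner_eq_zero hij, mul_zero]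

/-- This recovers the coordinate `z i` from the image under `A` whenever `A (b i) ≠ 0`. -/
lemma inner_map_sum_of_orthogonal {E F : Type*} [AddCommGroup E] [Module ℝ E]
    [NormedAddCommGroup F] [InnerProductSpace ℝ F] {ι : Type*} [Fintype ι] [DecidableEq ι]
    (A : E →ₗ[ℝ] F) {b : ι → E} (hb : ∀ i j, i ≠ j → inner ℝ (A (b i)) (A (b j)) = 0)
    (z : ι → ℝ) (i : ι) :
    inner ℝ (A (b i)) (A (∑ j, z j • b j)) = z i * ‖A (b i)‖ ^ 2 := by
  rw [map_sum, inner_sum, Finset.sum_eq_single i]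
  · rw [map_smul, inner_smul_right, real_inner_self_eq_norm_sq]
  · intro j _ hj
    rw [map_smul, inner_smul_right, hb i j hj.symm, mul_zero]
  · simp

lemma norm_toEuclideanCLM_sqrt_sq {n : ℕ} {R : Matrix (Fin n) (Fin n) ℝ} (hR : R.PosSemidef)
    (v : EuclideanSpace ℝ (Fin n)) :
    ‖toEuclideanCLM (𝕜 := ℝ) (CFC.sqrt R) v‖ ^ 2 = normSqV R v := by
  have hsa : IsSelfAdjoint (toEuclideanCLM (𝕜 := ℝ) (CFC.sqrt R)) :=
    (CFC.sqrt_nonneg R).isSelfAdjoint.map _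
  rw [← real_inner_self_eq_norm_sq, ← ContinuousLinearMap.adjoint_inner_right,
    hsa.adjoint_eq, ← ContinuousLinearMap.comp_apply, ← ContinuousLinearMap.mul_def, ← map_mul,
    CFC.sqrt_mul_sqrt_self _ hR.nonneg, inner_toEuclideanCLM]
  rfl

lemma transpose_sqrt {d : ℕ} (S : Matrix (Fin d) (Fin d) ℝ) : (CFC.sqrt S)ᵀ = CFC.sqrt S := by
  have h : IsSelfAdjoint (CFC.sqrt S) := (CFC.sqrt_nonneg S).isSelfAdjoint
  rwa [IsSelfAdjoint, star_eq_conjTranspose, conjTranspose_eq_transpose_of_trivial] at h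

lemma dotProduct_mulVec_toEuclideanCLM {d : ℕ} (C M : Matrix (Fin d) (Fin d) ℝ)
    (v : EuclideanSpace ℝ (Fin d)) :
    (toEuclideanCLM (𝕜 := ℝ) C v).ofLp ⬝ᵥ M *ᵥ (toEuclideanCLM (𝕜 := ℝ) C v).ofLp =
      inner ℝ v (toEuclideanCLM (𝕜 := ℝ) (Cᵀ * M * C) v) := by
  rw [inner_toEuclideanCLM, ofLp_toEuclideanCLM, ← mulVec_mulVec, ← mulVec_mulVec,
    dotProduct_mulVec _ Cᵀ, vecMul_transpose]

/-- The sum is the trace of `S^{1/2} Kᵀ M K S^{1/2}` in the basis `b`; cyclicity joins the two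
square roots into `S`. -/
lemma sum_dotProduct_mulVec_eq_trace {d : ℕ} (b : OrthonormalBasis (Fin d) ℝ
    (EuclideanSpace ℝ (Fin d))) {S : Matrix (Fin d) (Fin d) ℝ} (hS : S.PosSemidef)
    (K M : Matrix (Fin d) (Fin d) ℝ) :
    ∑ i, (toEuclideanCLM (𝕜 := ℝ) (K * CFC.sqrt S) (b i)).ofLp ⬝ᵥ
        M *ᵥ (toEuclideanCLM (𝕜 := ℝ) (K * CFC.sqrt S) (b i)).ofLp =
      (S * Kᵀ * M * K).trace := by
  simp_rw [dotProduct_mulVec_toEuclideanCLM]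
  have h := LinearMap.trace_eq_sum_inner
    (toEuclideanCLM (𝕜 := ℝ) ((K * CFC.sqrt S)ᵀ * M * (K * CFC.sqrt S))).toLinearMap b
  simp only [ContinuousLinearMap.coe_coe] at h
  rw [← h, coe_toEuclideanCLM_eq_toEuclideanLin, toEuclideanLin_eq_toLin_orthonormal,
    trace_toLin_eq, transpose_mul, transpose_sqrt, ← Matrix.mul_assoc, trace_mul_comm]
  simp only [← Matrix.mul_assoc]
  rw [CFC.sqrt_mul_sqrt_self _ hS.nonneg]

lemma normSqV_fderiv {d n : ℕ} (R : Matrix (Fin n) (Fin n) ℝ)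
    (f : EuclideanSpace ℝ (Fin d) → EuclideanSpace ℝ (Fin n)) (x v : EuclideanSpace ℝ (Fin d)) :
    normSqV R (fderiv ℝ f x v) = v.ofLp ⬝ᵥ gradGram R f x *ᵥ v.ofLp := by
  have hJ : (fderiv ℝ f x v).ofLp = jacobian f x *ᵥ v.ofLp := by
    ext i
    have hv : v = ∑ j, v j • EuclideanSpace.single j (1 : ℝ) := by
      simpa using ((EuclideanSpace.basisFun (Fin d) ℝ).sum_repr v).symm
    conv_lhs => rw [hv]
    simp [jacobian, mulVec, dotProduct, mul_comm]
  rw [normSqV, hJ, gradGram, ← mulVec_mulVec, ← mulVec_mulVec, dotProduct_mulVec _ (jacobian f x)ᵀ,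
    vecMul_transpose]

end LinearAlgebra

/-! ### Conditional Poincaré inequality for a general Gaussian -/

section ConditionalPoincare

open Matrix
open scoped MatrixOrder

/-- By rotation invariance, i.i.d. standard coordinates in any orthonormal basis give the standard
Gaussian; this leaves the basis free to be adapted to `P`. -/
lemma measurePreserving_multivariateGaussian {d : ℕ} (m : EuclideanSpace ℝ (Fin d))
    (S : Matrix (Fin d) (Fin d) ℝ) (b : OrthonormalBasis (Fin d) ℝ (EuclideanSpace ℝ (Fin d))) :
    MeasurePreserving
      (fun z : Fin d → ℝ => m + toEuclideanCLM (𝕜 := ℝ) (CFC.sqrt S) (∑ i, z i • b i))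
      (Measure.pi fun _ => gaussianReal 0 1) (multivariateGaussian m S) := by
  refine ⟨by fun_prop, ?_⟩
  rw [multivariateGaussian, stdGaussian_eq_map_pi_orthonormalBasis b,
    Measure.map_map (by fun_prop) (by fun_prop)]
  rfl

/-- Conditional Gaussian Poincaré inequality. The energy only involves the directions `S^{1/2} b i`
in the kernel of `P`, where `b` is an orthonormal basis adapted to `P S^{1/2}`. -/
lemma exists_orthonormalBasis_lintegral_sub_condExp_sq_le {d : ℕ} {W : Type*}
    [NormedAddCommGroup W] [InnerProductSpace ℝ W] [CompleteSpace W] [MeasurableSpace W]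
    [BorelSpace W] [SecondCountableTopology W] (m : EuclideanSpace ℝ (Fin d))
    (S P : Matrix (Fin d) (Fin d) ℝ) {h : EuclideanSpace ℝ (Fin d) → W} (hh : ContDiff ℝ 1 h)
    (hh2 : MemLp h 2 (multivariateGaussian m S)) :
    ∃ b : OrthonormalBasis (Fin d) ℝ (EuclideanSpace ℝ (Fin d)),
      ∫⁻ x, ‖h x - ((multivariateGaussian m S)[h | sigmaOf P]) x‖ₑ ^ 2
          ∂(multivariateGaussian m S) ≤
        ∑ i, ∫⁻ x, ‖fderiv ℝ h x (toEuclideanCLM (𝕜 := ℝ) ((1 - P) * CFC.sqrt S) (b i))‖ₑ ^ 2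
          ∂(multivariateGaussian m S) := by
  set Q := toEuclideanCLM (𝕜 := ℝ) (CFC.sqrt S) with hQ
  set A : EuclideanSpace ℝ (Fin d) →ₗ[ℝ] EuclideanSpace ℝ (Fin d) :=
    toEuclideanLin P ∘ₗ Q.toLinearMap with hA
  obtain ⟨b, hb⟩ := exists_orthonormalBasis_inner_map_eq_zero (finrank_euclideanSpace_fin) A
  refine ⟨b, ?_⟩
  set μ := multivariateGaussian m S with hμ
  set ν : Measure (Fin d → ℝ) := Measure.pi fun _ => gaussianReal 0 1 with hν
  set φ : (Fin d → ℝ) → EuclideanSpace ℝ (Fin d) := fun z => m + Q (∑ i, z i • b i) with hφ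
  have hφmp : MeasurePreserving φ ν μ := measurePreserving_multivariateGaussian m S b
  have hφd : ∀ z, HasFDerivAt φ (Q ∘L ∑ i, (ContinuousLinearMap.proj i).smulRight (b i)) z :=
    fun z => by
      have h1 : φ = fun z => m +
          (Q ∘L ∑ i, (ContinuousLinearMap.proj (R := ℝ) (φ := fun _ : Fin d => ℝ) i).smulRight
            (b i)) z := by
        ext1 z
        simp [hφ]
      rw [h1]
      exact (ContinuousLinearMap.hasFDerivAt _).const_add m
  have hφc : ContDiff ℝ 1 φ := by fun_prop
  set F : (Fin d → ℝ) → W := fun z => h (φ z) with hF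
  have hFc : ContDiff ℝ 1 F := hh.comp hφc
  have hF2 : MemLp F 2 ν := hh2.comp_measurePreserving hφmp
  have hFd : ∀ z i, fderiv ℝ F z (Pi.single i 1) = fderiv ℝ h (φ z) (Q (b i)) := fun z i => by
    have hd : HasFDerivAt F _ z :=
      (hh.differentiable one_ne_zero (φ z)).hasFDerivAt.comp z (hφd z)
    rw [hd.fderiv]
    simp [Pi.single_apply]
  -- The directions invisible to `P x`, which are to be averaged out.
  set s : Finset (Fin d) := Finset.univ.filter fun i => A (b i) = 0 with hs
  obtain ⟨hg2, hgle⟩ := lintegral_sub_partial_average_sq_le hFc hF2 s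
  set g : (Fin d → ℝ) → W := fun x => ∫ y, F (s.piecewise y x) ∂ν with hg
  have hgm : StronglyMeasurable g :=
    (hFc.continuous.stronglyMeasurable.comp_measurable
      (measurePreserving_piecewise (gaussianReal 0 1) s).measurable).integral_prod_right'
  -- The coordinates outside `s` are continuous functions of `P x`.
  set ψ : EuclideanSpace ℝ (Fin d) → Fin d → ℝ := fun p i =>
    inner ℝ (A (b i)) (p - toEuclideanLin P m) / ‖A (b i)‖ ^ 2 with hψ
  have hψc : Continuous ψ := by fun_prop
  have hψφ : ∀ z, ∀ i ∉ s, ψ (toEuclideanLin P (φ z)) i = z i := fun z i hi => by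
    have hne : A (b i) ≠ 0 := by simpa [hs] using hi
    have h1 : toEuclideanLin P (φ z) - toEuclideanLin P m = A (∑ j, z j • b j) := by
      simp only [hφ, map_add, add_sub_cancel_left]
      rfl
    simp only [hψ]
    rw [h1, inner_map_sum_of_orthogonal A hb, mul_div_cancel_right₀]
    exact pow_ne_zero 2 (norm_ne_zero_iff.2 hne)
  -- The competitor for the conditional expectation. `ψ` need not recover the coordinates in `s`,
  -- because `g` does not depend on them.
  set G : EuclideanSpace ℝ (Fin d) → W := fun x => g (ψ (toEuclideanLin P x)) with hG
  have hGφ : ∀ z, G (φ z) = g z := fun z => by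
    simp only [hG, hg]
    congr 1
    ext1 y
    congr 1
    ext i
    by_cases hi : i ∈ s
    · simp [hi]
    · simp [hi, hψφ z i hi]
  have hPm : Measurable fun x : EuclideanSpace ℝ (Fin d) => toEuclideanLin P x :=
    (toEuclideanLin P).continuous_of_finiteDimensional.measurable
  have hle : sigmaOf P ≤ (inferInstance : MeasurableSpace (EuclideanSpace ℝ (Fin d))) := by
    rw [sigmaOf, ← BorelSpace.measurable_eq (α := EuclideanSpace ℝ (Fin d))]
    exact hPm.comap_le
  have hGm : StronglyMeasurable[sigmaOf P] G := by
    have h1 : StronglyMeasurable fun p => g (ψ p) := hgm.comp_measurable hψc.measurable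
    have h2 : Measurable[sigmaOf P] fun x : EuclideanSpace ℝ (Fin d) => toEuclideanLin P x := by
      rw [BorelSpace.measurable_eq (α := EuclideanSpace ℝ (Fin d))]
      exact comap_measurable _
    exact h1.comp_measurable h2
  have hG2 : MemLp G 2 μ := by
    rw [← hφmp.map_eq, memLp_map_measure_iff (hGm.mono hle).aestronglyMeasurable
      hφmp.measurable.aemeasurable]
    exact hg2.congr_norm ((hGm.mono hle).comp_measurable hφmp.measurable).aestronglyMeasurable
      (ae_of_all _ fun z => by simp [hGφ])
  have hker : ∀ i ∈ s, toEuclideanCLM (𝕜 := ℝ) ((1 - P) * CFC.sqrt S) (b i) = Q (b i) :=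
    fun i hi => by
      have h0 : toEuclideanLin P (Q (b i)) = 0 := by simpa [hs, hA] using hi
      rw [map_mul, map_sub, map_one, mul_apply_eq_comp, _root_.sub_apply,
        one_apply_eq_self, ← hQ]
      have h1 : toEuclideanCLM (𝕜 := ℝ) P (Q (b i)) = 0 := h0
      rw [h1, sub_zero]
  have hdm : ∀ v, Measurable fun x => ‖fderiv ℝ h x v‖ₑ ^ 2 := fun v =>
    ((hh.continuous_fderiv one_ne_zero).clm_apply continuous_const).measurable.enorm.pow_const 2
  calc ∫⁻ x, ‖h x - (μ[h | sigmaOf P]) x‖ₑ ^ 2 ∂μ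
      ≤ ∫⁻ x, ‖h x - G x‖ₑ ^ 2 ∂μ := lintegral_sub_condExp_sq_le hle hh2 hGm hG2
    _ = ∫⁻ z, ‖F z - g z‖ₑ ^ 2 ∂ν := by
        have hm : Measurable fun x => ‖h x - G x‖ₑ ^ 2 :=
          (hh.continuous.stronglyMeasurable.sub (hGm.mono hle)).enorm.pow_const 2
        rw [← hφmp.lintegral_comp hm]
        simp only [hGφ, hF]
    _ ≤ ∑ i ∈ s, ∫⁻ z, ‖fderiv ℝ F z (Pi.single i 1)‖ₑ ^ 2 ∂ν := hgle
    _ = ∑ i ∈ s, ∫⁻ x, ‖fderiv ℝ h x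
          (toEuclideanCLM (𝕜 := ℝ) ((1 - P) * CFC.sqrt S) (b i))‖ₑ ^ 2 ∂μ := by
        refine Finset.sum_congr rfl fun i hi => ?_
        simp only [hFd, hker i hi]
        exact hφmp.lintegral_comp (hdm (Q (b i)))
    -- The added terms are nonnegative; a sum over the whole basis is needed to obtain a trace.
    _ ≤ _ := Finset.sum_le_sum_of_subset (Finset.subset_univ s)

end ConditionalPoincare

/-! ### Weighted norm on `V` and the trace bound -/

section Main

open Matrix
open scoped MatrixOrder

lemma integral_dotProduct_gradGram {d n : ℕ} {μ : Measure (EuclideanSpace ℝ (Fin d))}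
    {R : Matrix (Fin n) (Fin n) ℝ} {f : EuclideanSpace ℝ (Fin d) → EuclideanSpace ℝ (Fin n)}
    (hH : ∀ i j, Integrable (fun x => gradGram R f x i j) μ) (v : Fin d → ℝ) :
    Integrable (fun x => v ⬝ᵥ gradGram R f x *ᵥ v) μ ∧
      ∫ x, v ⬝ᵥ gradGram R f x *ᵥ v ∂μ = v ⬝ᵥ matrixH μ R f *ᵥ v := by
  have hi : ∀ i j, Integrable (fun x => v i * (gradGram R f x i j * v j)) μ := fun i j =>
    ((hH i j).mul_const _).const_mul _
  simp only [dotProduct, mulVec, Finset.mul_sum]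
  refine ⟨integrable_finsetSum _ fun i _ => integrable_finsetSum _ fun j _ => hi i j, ?_⟩
  rw [integral_finsetSum _ fun i _ => integrable_finsetSum _ fun j _ => hi i j]
  refine Finset.sum_congr rfl fun i _ => ?_
  rw [integral_finsetSum _ fun j _ => hi i j]
  refine Finset.sum_congr rfl fun j _ => ?_
  rw [integral_const_mul, integral_mul_const]
  rfl

lemma ofReal_normSqV {n : ℕ} {R : Matrix (Fin n) (Fin n) ℝ} (hR : R.PosSemidef)
    (v : EuclideanSpace ℝ (Fin n)) :
    ENNReal.ofReal (normSqV R v) = ‖toEuclideanCLM (𝕜 := ℝ) (CFC.sqrt R) v‖ₑ ^ 2 := by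
  rw [← norm_toEuclideanCLM_sqrt_sq hR, ENNReal.ofReal_pow (norm_nonneg _), ofReal_norm]

/-- Positive definiteness makes `R^{1/2}` invertible, so square integrability passes from `R^{1/2}
f` back to `f`. -/
lemma MemH.memLp_two {d n : ℕ} {μ : Measure (EuclideanSpace ℝ (Fin d))}
    {R : Matrix (Fin n) (Fin n) ℝ} (hR : R.PosDef)
    {f : EuclideanSpace ℝ (Fin d) → EuclideanSpace ℝ (Fin n)} (hf : MemH μ R f) :
    MemLp f 2 μ := by
  set B := CFC.sqrt R with hB
  have hBB : B * B = R := CFC.sqrt_mul_sqrt_self _ hR.posSemidef.nonneg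
  have hdet : IsUnit B.det := by
    refine isUnit_iff_ne_zero.2 fun h0 => hR.det_pos.ne' ?_
    rw [← hBB, det_mul, h0, mul_zero]
  have hh : MemLp (fun x => toEuclideanCLM (𝕜 := ℝ) B (f x)) 2 μ := by
    refine (memLp_two_iff_lintegral_enorm_sq_lt_top
      ((toEuclideanCLM (𝕜 := ℝ) B).continuous.comp_aestronglyMeasurable hf.1)).2 ?_
    have h2 := hf.2
    simp only [normSqH, ofReal_normSqV hR.posSemidef] at h2
    exact h2
  have hinv : ∀ v, toEuclideanCLM (𝕜 := ℝ) B⁻¹ (toEuclideanCLM (𝕜 := ℝ) B v) = v := fun v => by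
    rw [← mul_apply_eq_comp, ← map_mul, nonsing_inv_mul _ hdet, map_one,
      one_apply_eq_self]
  have h3 := hh.continuousLinearMap_comp (toEuclideanCLM (𝕜 := ℝ) B⁻¹)
  simpa only [hinv] using h3

/-- The bound holds for an arbitrary matrix `P`, not only for projectors. -/
theorem normSqH_sub_condExp_le_trace {d n : ℕ} (m : EuclideanSpace ℝ (Fin d))
    (S : Matrix (Fin d) (Fin d) ℝ) (hS : S.PosDef)
    (R : Matrix (Fin n) (Fin n) ℝ) (hR : R.PosDef)
    (f : EuclideanSpace ℝ (Fin d) → EuclideanSpace ℝ (Fin n))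
    (hf : ContDiff ℝ 1 f)
    (hfH : MemH (multivariateGaussian m S) R f)
    (hH : ∀ i j, Integrable (fun x => gradGram R f x i j) (multivariateGaussian m S))
    (P : Matrix (Fin d) (Fin d) ℝ) :
    normSqH (multivariateGaussian m S) R
        (fun x => f x - ((multivariateGaussian m S)[f | sigmaOf P]) x)
      ≤ ENNReal.ofReal
        (Matrix.trace
          (S * (1 - P.transpose) * matrixH (multivariateGaussian m S) R f * (1 - P))) := by
  set μ := multivariateGaussian m S with hμ
  set L := Matrix.toEuclideanCLM (𝕜 := ℝ) (CFC.sqrt R) with hL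
  have hf2 : MemLp f 2 μ := hfH.memLp_two hR
  have hh2 : MemLp (fun x => L (f x)) 2 μ := hf2.continuousLinearMap_comp L
  have hhc : ContDiff ℝ 1 fun x => L (f x) := L.contDiff.comp hf
  obtain ⟨b, hb⟩ := exists_orthonormalBasis_lintegral_sub_condExp_sq_le m S P hhc hh2
  have hLcond := L.comp_condExp_comm (m := sigmaOf P) (hf2.integrable one_le_two)
  have hfd : ∀ x v, fderiv ℝ (fun x => L (f x)) x v = L (fderiv ℝ f x v) := fun x v => by
    have hd : HasFDerivAt (fun x => L (f x)) (L ∘L fderiv ℝ f x) x :=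
      L.hasFDerivAt.comp x (hf.differentiable one_ne_zero x).hasFDerivAt
    rw [hd.fderiv]
    rfl
  set c : Fin d → EuclideanSpace ℝ (Fin d) := fun i =>
    Matrix.toEuclideanCLM (𝕜 := ℝ) ((1 - P) * CFC.sqrt S) (b i) with hc
  have hint := fun i => integral_dotProduct_gradGram hH (c i).ofLp
  have hnonneg : ∀ x v, 0 ≤ normSqV R (fderiv ℝ f x v) := fun x v => by
    rw [← norm_toEuclideanCLM_sqrt_sq hR.posSemidef]
    positivity
  calc normSqH μ R (fun x => f x - (μ[f | sigmaOf P]) x)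
      = ∫⁻ x, ‖L (f x) - (μ[fun x => L (f x) | sigmaOf P]) x‖ₑ ^ 2 ∂μ := by
        refine lintegral_congr_ae ?_
        filter_upwards [hLcond] with x hx
        rw [ofReal_normSqV hR.posSemidef, map_sub]
        congr 3
    _ ≤ ∑ i, ∫⁻ x, ‖fderiv ℝ (fun x => L (f x)) x (c i)‖ₑ ^ 2 ∂μ := hb
    _ = ∑ i, ENNReal.ofReal ((c i).ofLp ⬝ᵥ (matrixH μ R f).mulVec (c i).ofLp) := by
        refine Finset.sum_congr rfl fun i _ => ?_
        rw [← (hint i).2, ofReal_integral_eq_lintegral_ofReal (hint i).1]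
        · refine lintegral_congr fun x => ?_
          rw [hfd, ← normSqV_fderiv, ofReal_normSqV hR.posSemidef]
        · exact ae_of_all _ fun x => by
            simp only [Pi.zero_apply]
            rw [← normSqV_fderiv]
            exact hnonneg x _
    _ = ENNReal.ofReal
        (Matrix.trace (S * (1 - P.transpose) * matrixH μ R f * (1 - P))) := by
        rw [← ENNReal.ofReal_sum_of_nonneg, sum_dotProduct_mulVec_eq_trace b hS.posSemidef,
          Matrix.transpose_sub, Matrix.transpose_one]
        intro i _
        rw [← (hint i).2]
        refine integral_nonneg fun x => ?_
        simp only [Pi.zero_apply]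
        rw [← normSqV_fderiv]
        exact hnonneg x _

end Main

theorem proposition2p4 {d n : ℕ} (m : EuclideanSpace ℝ (Fin d))
    (S : Matrix (Fin d) (Fin d) ℝ) (hS : S.PosDef)
    (R : Matrix (Fin n) (Fin n) ℝ) (hR : R.PosDef)
    (f : EuclideanSpace ℝ (Fin d) → EuclideanSpace ℝ (Fin n))
    (hf : ContDiff ℝ 1 f)
    (hfH : MemH (multivariateGaussian m S) R f)
    (hH : ∀ i j, Integrable (fun x => gradGram R f x i j) (multivariateGaussian m S))
    (P : Matrix (Fin d) (Fin d) ℝ) (hP : P * P = P) :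
    normSqH (multivariateGaussian m S) R
        (fun x => f x - ((multivariateGaussian m S)[f | sigmaOf P]) x)
      ≤ ENNReal.ofReal
        (Matrix.trace (S * (1 - P.transpose) * matrixH (multivariateGaussian m S) R f * (1 - P))) := by
  exact normSqH_sub_condExp_le_trace m S hS R hR f hf hfH hH P
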